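/- Let $R$ be a Cohen–Macaulay (commutative Noetherian) local ring of Krull dimension $1$ with a canonical module $\omega$, and suppose that $\omega$ has rank (equivalently, $R$ is generically Gorenstein). Write $(-)^{*}=\operatorname{Hom}_R(-,R)$ and $(-)^{\vee}=\operatorname{Hom}_R(-,\omega)$. An $R$-module $M$ is said to have rank if there is an integer $r\ge 0$ with $M_{\mathfrak p}\cong R_{\mathfrak p}^{\oplus r}$ for all $\mathfrak p\in\operatorname{Ass}_R(R)$, and $M$ is torsion-free if every nonzerodivisor of $R$ acts injectively on $M$. Then the following two assertions about $R$ are equivalent. 1. (Huneke–Wiegand) If $M$ is a finitely generated torsion-free $R$-module with rank such that $M^{*}\otimes_R M$ is torsion-free, then $M$ is free. 2. If $M$ is a finitely generated torsion-free $R$-module with rank such that $M^{\vee}\otimes_R\operatorname{Hom}_R(\omega,M)$ is torsion-free, then $M\cong\omega^{\oplus n}$ for some $n\ge 0$. -/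

import Mathlib

open scoped TensorProduct

universe u

namespace HunekeWiegand

open CategoryTheory IsLocalRing

noncomputable section

/-- The depth of a finitely generated module `M` over a Noetherian local ring `R`: the supremum of
the lengths of the `M`-regular sequences consisting of elements of the maximal ideal. -/
def depth (R : Type u) [CommRing R] [IsLocalRing R] (M : Type u) [AddCommGroup M] [Module R M] :
    ℕ∞ :=
  ⨆ (rs : List R) (_ : (∀ r ∈ rs, r ∈ maximalIdeal R) ∧ RingTheory.Sequence.IsRegular M rs),
    (rs.length : ℕ∞)

/-- The module `M` is maximal Cohen-Macaulay: `depth M = dim R`. -/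
def IsMaximalCohenMacaulay (R : Type u) [CommRing R] [IsLocalRing R] (M : Type u) [AddCommGroup M]
    [Module R M] : Prop :=
  (depth R M : WithBot ℕ∞) = ringKrullDim R

/-- A Noetherian local ring is Cohen-Macaulay if its depth equals its Krull dimension. -/
def IsCohenMacaulayLocalRing (R : Type u) [CommRing R] [IsLocalRing R] : Prop :=
  IsNoetherianRing R ∧ IsMaximalCohenMacaulay R R

/-- The (Cohen-Macaulay) type of `M` over a local ring with residue field `k`: the `k`-dimension of
`Ext^t_R(k, M)` with `t = depth M`. Since `Ext^t_R(k, M)` is killed by the maximal ideal, its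
dimension over `k` is its length over `R`. -/
def cmType (R : Type u) [CommRing R] [IsLocalRing R] (M : Type u) [AddCommGroup M]
    [Module R M] : ℕ∞ :=
  Module.length R
    (Abelian.Ext (ModuleCat.of R (ResidueField R)) (ModuleCat.of R M) (depth R M).toNat)

/-- A canonical module of a Cohen-Macaulay local ring `R`: a finitely generated maximal
Cohen-Macaulay module of type one and of finite injective dimension. -/
structure IsCanonicalModule (R : Type u) [CommRing R] [IsLocalRing R] (ω : Type u) [AddCommGroup ω]
    [Module R ω] : Prop where
  finite : Module.Finite R ω
  maximalCohenMacaulay : IsMaximalCohenMacaulay R ω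
  type_eq_one : cmType R ω = 1
  finite_injectiveDimension : ∃ n : ℕ, HasInjectiveDimensionLE (ModuleCat.of R ω) n

/-- The `R`-module `M` has rank: there is `r` with `M_𝔭 ≅ R_𝔭^r` for every `𝔭 ∈ Ass R`. -/
def HasRank (R : Type u) [CommRing R] (M : Type u) [AddCommGroup M] [Module R M] : Prop :=
  ∃ r : ℕ, ∀ (p : Ideal R) [p.IsPrime], p ∈ associatedPrimes R R →
    Nonempty (LocalizedModule p.primeCompl M ≃ₗ[Localization.AtPrime p]
      (Fin r → Localization.AtPrime p))

/-- The assertion of the Huneke-Wiegand conjecture for the ring `R`: if `M` is a finitely generated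
torsion-free module with rank and `M^* ⊗ M` is torsion-free, then `M` is free. Here
`Module.IsTorsionFree R N` means that every nonzerodivisor of `R` is a nonzerodivisor on `N`. -/
def Conjecture (R : Type u) [CommRing R] : Prop :=
  ∀ (M : Type u) [AddCommGroup M] [Module R M], Module.Finite R M → Module.IsTorsionFree R M →
    HasRank R M → Module.IsTorsionFree R ((M →ₗ[R] R) ⊗[R] M) → Module.Free R M

/-- The variant for the module `ω`: if `M` is a finitely generated torsion-free module with rank and
`Hom(M, ω) ⊗ Hom(ω, M)` is torsion-free, then `M ≅ ω^n` for some `n`. -/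
def CanonicalConjecture (R : Type u) [CommRing R] (ω : Type u) [AddCommGroup ω] [Module R ω] :
    Prop :=
  ∀ (M : Type u) [AddCommGroup M] [Module R M], Module.Finite R M → Module.IsTorsionFree R M →
    HasRank R M → Module.IsTorsionFree R ((M →ₗ[R] ω) ⊗[R] (ω →ₗ[R] M)) →
      ∃ n : ℕ, Nonempty (M ≃ₗ[R] (Fin n → ω))

end

end HunekeWiegand

/-! The dual `M^∨ = Hom(M, ω)` is an involution on finitely generated torsion-free modules with
rank, and it exchanges free modules with powers of `ω`. Since `Hom(ω, ω) ≅ R`, swapping arguments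
gives `Hom(ω, M^∨) ≅ M^*`, so the tensor product of one assertion for `M^∨` is that of the other for
`M`.

The work lies in biduality `M ≅ M^∨∨` (`IsCanonicalModule.bijective_eval`). Fix a regular `x` in the
maximal ideal. Finite injective dimension forces `Ext^1(M, ω) = 0` for torsion-free `M`
(`ext_one_subsingleton`), so maps `M → ω/xω` lift to `ω`. Hence `ω/xω` is injective for finitely
generated modules killed by `x`. Type one bounds its socle by length one, and counting lengths gives
Matlis duality modulo `x`. Nakayama's lemma carries it back to `M`. -/

namespace HunekeWiegand

open CategoryTheory IsLocalRing Abelian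
open scoped Pointwise

/-! ### Regular elements in dimension one -/

section DimensionOne

variable {R : Type u} [CommRing R] [IsLocalRing R]

theorem eq_maximalIdeal_of_mem_of_isRegular (hdim : ringKrullDim R = 1) {x : R}
    (hx : IsRegular x) (p : Ideal R) [p.IsPrime] (hxp : x ∈ p) : p = maximalIdeal R := by
  have : Ring.KrullDimLE 1 R := by
    rw [Ring.krullDimLE_iff, hdim]; rfl
  rcases Ring.krullDimLE_one_iff.mp this p inferInstance with h | h
  · exact absurd hxp fun hxp => Set.disjoint_left.mp
      (Ideal.disjoint_nonZeroDivisors_of_mem_minimalPrimes h) hxp hx.mem_nonZeroDivisors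
  · exact IsLocalRing.eq_maximalIdeal h

/-- Only the maximal ideal can be a prime over `x`, so the radical of `(x)` contains `y`. -/
theorem exists_pow_mem_span_of_isRegular (hdim : ringKrullDim R = 1) {x : R}
    (hx : IsRegular x) {y : R} (hy : y ∈ maximalIdeal R) : ∃ n : ℕ, y ^ n ∈ Ideal.span {x} := by
  have : y ∈ (Ideal.span {x}).radical := by
    rw [Ideal.radical_eq_sInf, Ideal.mem_sInf]
    rintro p ⟨hp, hp'⟩
    rw [eq_maximalIdeal_of_mem_of_isRegular hdim hx p (hp (Ideal.mem_span_singleton_self x))]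
    exact hy
  exact this

/-- A maximal Cohen-Macaulay module over a local ring of dimension one is nonzero and
admits a regular element in the maximal ideal. -/
theorem IsMaximalCohenMacaulay.exists_isSMulRegular (hdim : ringKrullDim R = 1)
    {M : Type u} [AddCommGroup M] [Module R M] (hM : IsMaximalCohenMacaulay R M) :
    Nontrivial M ∧ depth R M = 1 ∧ ∃ y ∈ maximalIdeal R, IsSMulRegular M y := by
  have h1 : depth R M = 1 := by
    have h : (depth R M : WithBot ℕ∞) = 1 := hM.trans hdim
    exact_mod_cast h
  have : ∃ rs : List R, ((∀ r ∈ rs, r ∈ maximalIdeal R) ∧ RingTheory.Sequence.IsRegular M rs) ∧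
      rs ≠ [] := by
    by_contra! H
    have : depth R M ≤ 0 := iSup₂_le fun rs hrs => by simp [H rs hrs]
    rw [h1] at this
    exact absurd this (by simp)
  obtain ⟨rs, ⟨hmem, hreg⟩, hne⟩ := this
  refine ⟨hreg.nontrivial, h1, ?_⟩
  match rs, hne with
  | r :: rs, _ =>
    exact ⟨r, hmem r (by simp),
      ((RingTheory.Sequence.isRegular_cons_iff M r rs).mp hreg).1⟩

/-- Over a local ring of dimension one, a module with a regular element in the maximal ideal is
torsion-free. -/
theorem isTorsionFree_of_isSMulRegular (hdim : ringKrullDim R = 1)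
    {M : Type u} [AddCommGroup M] [Module R M] {y : R} (hy : y ∈ maximalIdeal R)
    (hreg : IsSMulRegular M y) : Module.IsTorsionFree R M where
  isSMulRegular r hr := by
    obtain ⟨n, hn⟩ := exists_pow_mem_span_of_isRegular hdim hr hy
    obtain ⟨z, hz⟩ := Ideal.mem_span_singleton'.mp hn
    have h : IsSMulRegular M (z * r) := hz ▸ hreg.pow n
    exact IsSMulRegular.of_mul h

end DimensionOne

/-! ### Vanishing of Ext into a module of finite injective dimension -/

section Ext

variable {R : Type u} [CommRing R] {S : ShortComplex (ModuleCat.{u} R)} (hS : S.ShortExact)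
  (Y : ModuleCat.{u} R) (n : ℕ)

include hS

theorem ext_subsingleton_first (h₂ : Subsingleton (Ext S.X₂ Y n))
    (h₃ : Subsingleton (Ext S.X₃ Y (n + 1))) : Subsingleton (Ext S.X₁ Y n) := by
  refine subsingleton_of_forall_eq 0 fun e => ?_
  obtain ⟨e', rfl⟩ := Ext.contravariant_sequence_exact₁ hS Y e (add_comm 1 n)
    (Subsingleton.elim _ _)
  rw [Subsingleton.elim e' 0, Ext.comp_zero]

theorem ext_subsingleton_middle (h₁ : Subsingleton (Ext S.X₁ Y n))
    (h₃ : Subsingleton (Ext S.X₃ Y n)) : Subsingleton (Ext S.X₂ Y n) := by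
  refine subsingleton_of_forall_eq 0 fun e => ?_
  obtain ⟨e', rfl⟩ := Ext.contravariant_sequence_exact₂ hS Y e (Subsingleton.elim _ _)
  rw [Subsingleton.elim e' 0, Ext.comp_zero]

theorem ext_subsingleton_third (h₁ : Subsingleton (Ext S.X₁ Y n))
    (h₂ : Subsingleton (Ext S.X₂ Y (n + 1))) : Subsingleton (Ext S.X₃ Y (n + 1)) := by
  refine subsingleton_of_forall_eq 0 fun e => ?_
  obtain ⟨e', rfl⟩ := Ext.contravariant_sequence_exact₃ hS Y e (Subsingleton.elim _ _)
    (add_comm 1 n)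
  rw [Subsingleton.elim e' 0, Ext.comp_zero]

end Ext

section ExtModule

variable {R : Type u} [CommRing R]

theorem shortExact_of_exact {A B C : Type u} [AddCommGroup A] [AddCommGroup B] [AddCommGroup C]
    [Module R A] [Module R B] [Module R C] (f : A →ₗ[R] B) (g : B →ₗ[R] C)
    (hf : Function.Injective f) (hg : Function.Surjective g) (hfg : Function.Exact f g) :
    (ShortComplex.moduleCatMk f g hfg.linearMap_comp_eq_zero).ShortExact where
  exact := by
    rw [ShortComplex.ShortExact.moduleCat_exact_iff_function_exact]
    exact hfg
  mono_f := (ModuleCat.mono_iff_injective _).mpr hf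
  epi_g := (ModuleCat.epi_iff_surjective _).mpr hg

theorem ext_subsingleton_of_linearEquiv {A B : Type u} [AddCommGroup A] [AddCommGroup B]
    [Module R A] [Module R B] (e : A ≃ₗ[R] B) (Y : ModuleCat.{u} R) (n : ℕ)
    (h : Subsingleton (Ext (ModuleCat.of R B) Y n)) : Subsingleton (Ext (ModuleCat.of R A) Y n) := by
  refine subsingleton_of_forall_eq 0 fun a => ?_
  have : (Ext.mk₀ e.toModuleIso.hom).comp ((Ext.mk₀ e.toModuleIso.inv).comp a (zero_add n))
      (zero_add n) = a := by
    rw [Ext.mk₀_comp_mk₀_assoc, Iso.hom_inv_id, Ext.mk₀_id_comp]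
  rw [← this, Subsingleton.elim ((Ext.mk₀ e.toModuleIso.inv).comp a (zero_add n)) 0, Ext.comp_zero]

/-- If `Ext^1(M, N)` vanishes then homomorphisms `M → N / xN` lift to `N` for an `N`-regular
element `x`. -/
theorem exists_lift_quotSMulTop {N M : Type u} [AddCommGroup N] [Module R N] [AddCommGroup M]
    [Module R M] {x : R} (hN : IsSMulRegular N x)
    (h : Subsingleton (Ext (ModuleCat.of R M) (ModuleCat.of R N) 1))
    (f : M →ₗ[R] QuotSMulTop x N) :
    ∃ g : M →ₗ[R] N, (x • (⊤ : Submodule R N)).mkQ ∘ₗ g = f := by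
  have hS := IsSMulRegular.smulShortComplex_shortExact (M := ModuleCat.of R N) hN
  obtain ⟨g', hg'⟩ := Ext.covariant_sequence_exact₃ (ModuleCat.of R M) hS
    (Ext.mk₀ (ModuleCat.ofHom f)) (zero_add 1) (@Subsingleton.elim _ h _ _)
  obtain ⟨g, rfl⟩ := (Ext.mk₀_bijective _ _).2 g'
  replace hg' := (Ext.mk₀_bijective _ _).1 ((Ext.mk₀_comp_mk₀ _ _).symm.trans hg')
  refine ⟨g.hom, ?_⟩
  exact congrArg ModuleCat.Hom.hom hg'

/-- For an `N`-regular element `x` annihilating `K`, the module `Hom(K, N / xN)` embeds into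
`Ext^1(K, N)`. -/
theorem length_linearMap_quotSMulTop_le {K N : Type u} [AddCommGroup N] [Module R N]
    [AddCommGroup K] [Module R K] {x : R} (hN : IsSMulRegular N x) (hK : ∀ k : K, x • k = 0) :
    Module.length R (K →ₗ[R] QuotSMulTop x N) ≤
      Module.length R (Ext (ModuleCat.of R K) (ModuleCat.of R N) 1) := by
  have hS := IsSMulRegular.smulShortComplex_shortExact (M := ModuleCat.of R N) hN
  let φ : (K →ₗ[R] QuotSMulTop x N) →ₗ[R] Ext (ModuleCat.of R K) (ModuleCat.of R N) 1 :=
    (hS.extClass.postcompOfLinear R (ModuleCat.of R K) (zero_add 1)) ∘ₗ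
      (Ext.linearEquiv₀ (R := R)).symm.toLinearMap ∘ₗ
        (ModuleCat.homLinearEquiv (S := R) (M := ModuleCat.of R K)
          (N := ModuleCat.of R (QuotSMulTop x N))).symm.toLinearMap
  refine Module.length_le_of_injective φ ((injective_iff_map_eq_zero φ).mpr fun f hf => ?_)
  obtain ⟨g', hg'⟩ := Ext.covariant_sequence_exact₃ (ModuleCat.of R K) hS
    (Ext.mk₀ (ModuleCat.ofHom f)) (zero_add 1) hf
  obtain ⟨g, rfl⟩ := (Ext.mk₀_bijective _ _).2 g'
  replace hg' := (Ext.mk₀_bijective _ _).1 ((Ext.mk₀_comp_mk₀ _ _).symm.trans hg')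
  -- A map whose connecting class vanishes lifts to `N`; the lift is zero because `x` kills `K` and
  -- is regular on `N`.
  have h0 : g.hom = 0 := LinearMap.ext fun k => hN (by
    have : x • g.hom k = x • 0 := by rw [← map_smul, hK, map_zero, smul_zero]
    exact this)
  have h1 : (x • (⊤ : Submodule R N)).mkQ ∘ₗ g.hom = f := congrArg ModuleCat.Hom.hom hg'
  rw [← h1]
  exact (congrArg ((x • (⊤ : Submodule R N)).mkQ ∘ₗ ·) h0).trans (LinearMap.comp_zero _)

variable [IsLocalRing R] [IsNoetherianRing R]

/-- The long exact sequence of multiplication by `x` makes `x` surjective on `Ext^n(M, Y)`, which is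
finitely generated, so Nakayama applies. -/
theorem ext_subsingleton_of_isSMulRegular (M Y : ModuleCat.{u} R) [Module.Finite R M]
    [Module.Finite R Y] {x : R} (hx : x ∈ maximalIdeal R) (hreg : IsSMulRegular M x) (n : ℕ)
    (h : Subsingleton (Ext (ModuleCat.of R (QuotSMulTop x M)) Y (n + 1))) :
    Subsingleton (Ext M Y n) := by
  have key : (⊤ : Submodule R (Ext M Y n)) ≤ Ideal.span {x} • ⊤ := by
    intro e _
    obtain ⟨e', he'⟩ : ∃ e' : Ext M Y n, (Ext.mk₀ (x • 𝟙 M)).comp e' (zero_add n) = e :=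
      Ext.contravariant_sequence_exact₁ hreg.smulShortComplex_shortExact Y e
        (add_comm 1 n) (@Subsingleton.elim _ h _ _)
    have : x • e' = e := by
      rw [← he', Ext.mk₀_smul, Ext.smul_comp, Ext.mk₀_id_comp]
    rw [← this]
    exact Submodule.smul_mem_smul (Ideal.mem_span_singleton_self x) trivial
  have := Submodule.eq_bot_of_le_smul_of_le_jacobson_bot (Ideal.span {x})
    (⊤ : Submodule R (Ext M Y n)) Module.Finite.fg_top key
    (by rw [Ideal.span_singleton_le_iff_mem, IsLocalRing.jacobson_eq_maximalIdeal ⊥ bot_ne_top]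
        exact hx)
  exact (Submodule.subsingleton_iff R).mp (subsingleton_of_bot_eq_top this.symm)

/-- The residue field embeds into a nonzero module over a Noetherian ring which is annihilated by
an element lying in no prime ideal but the maximal one. -/
theorem exists_residueField_injective {x : R}
    (hmax : ∀ p : Ideal R, p.IsPrime → x ∈ p → p = maximalIdeal R)
    (N : Type u) [AddCommGroup N] [Module R N] [Nontrivial N] (hN : ∀ n : N, x • n = 0) :
    ∃ f : R ⧸ maximalIdeal R →ₗ[R] N, Function.Injective f := by
  obtain ⟨p, hp⟩ := associatedPrimes.nonempty R N
  obtain ⟨n, hn⟩ := ((isAssociatedPrime_iff_exists_injective_linearMap p N).mp hp).2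
  have := hmax p hp.1 (by
    have h : n (x • (1 : R ⧸ p)) = 0 := by rw [map_smul, hN]
    have h' := hn (h.trans (map_zero n).symm)
    rw [Algebra.smul_def, mul_one] at h'
    exact Ideal.Quotient.eq_zero_iff_mem.mp h')
  subst this
  exact ⟨n, hn⟩

/-- The residue field embeds into `R/xR`, whose projective dimension is at most one, so
`Ext^(n+2)(R/xR, Y) = 0`; the cokernel contributes only in degree `n + 3`. -/
theorem ext_residueField_subsingleton {x : R} (hreg : IsSMulRegular R x)
    (hx : x ∈ maximalIdeal R) (hmax : ∀ p : Ideal R, p.IsPrime → x ∈ p → p = maximalIdeal R)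
    (Y : ModuleCat.{u} R) (n : ℕ)
    (h : ∀ (X : Type u) [AddCommGroup X] [Module R X] [Module.Finite R X],
      Subsingleton (Ext (ModuleCat.of R X) Y (n + 3))) :
    Subsingleton (Ext (ModuleCat.of R (R ⧸ maximalIdeal R)) Y (n + 2)) := by
  have : Nontrivial (QuotSMulTop x R) := nontrivial_quotSMulTop_of_mem_maximalIdeal R hx
  obtain ⟨f, hf⟩ := exists_residueField_injective hmax (QuotSMulTop x R) fun n => by
    exact Module.mem_annihilator.mp (QuotSMulTop.mem_annihilator R x) n
  have hS := shortExact_of_exact f (LinearMap.range f).mkQ hf (Submodule.mkQ_surjective _)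
    (LinearMap.exact_map_mkQ_range f)
  refine ext_subsingleton_first hS Y (n + 2) ?_ (h _)
  have hS' := IsSMulRegular.smulShortComplex_shortExact (M := ModuleCat.of R R) hreg
  have hP (m : ℕ) : Subsingleton (Ext (ModuleCat.of R R) Y (m + 1)) :=
    Ext.subsingleton_of_projective _ Y m
  exact ext_subsingleton_third hS' Y (n + 1) (hP n) (hP (n + 1))

/-- A prime filtration reduces to `R/p`. For `p` maximal the residue field case applies; otherwise
some `y` in the maximal ideal is regular on `R/p`, and Nakayama lowers the degree. -/
theorem ext_subsingleton_descend {x : R} (hreg : IsSMulRegular R x)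
    (hx : x ∈ maximalIdeal R) (hmax : ∀ p : Ideal R, p.IsPrime → x ∈ p → p = maximalIdeal R)
    (Y : ModuleCat.{u} R) [Module.Finite R Y] (n : ℕ)
    (h : ∀ (X : Type u) [AddCommGroup X] [Module R X] [Module.Finite R X],
      Subsingleton (Ext (ModuleCat.of R X) Y (n + 3)))
    (X : Type u) [AddCommGroup X] [Module R X] [hX : Module.Finite R X] :
      Subsingleton (Ext (ModuleCat.of R X) Y (n + 2)) := by
  induction hX using IsNoetherianRing.induction_on_isQuotientEquivQuotientPrime R with
  | subsingleton N =>
    have : Projective (ModuleCat.of R N) := by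
      have : Module.Projective R N := Module.Projective.of_free
      infer_instance
    exact Ext.subsingleton_of_projective _ Y (n + 1)
  | quotient N p e =>
    refine ext_subsingleton_of_linearEquiv e Y _ ?_
    by_cases hp : p.1 = maximalIdeal R
    · rw [hp]
      exact ext_residueField_subsingleton hreg hx hmax Y n h
    · obtain ⟨y, hym, hyp⟩ := SetLike.exists_of_lt
        (lt_of_le_of_ne (IsLocalRing.le_maximalIdeal p.2.ne_top) hp)
      refine ext_subsingleton_of_isSMulRegular (ModuleCat.of R (R ⧸ p.1)) Y hym ?_ (n + 2) (h _)
      have := p.2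
      refine isSMulRegular_iff_right_eq_zero_of_smul.mpr fun a ha => ?_
      rw [Algebra.smul_def] at ha
      refine (mul_eq_zero.mp ha).resolve_left fun h0 => hyp ?_
      exact Ideal.Quotient.eq_zero_iff_mem.mp h0
  | exact A B C f g hf hg hfg hA hC =>
    exact ext_subsingleton_middle (shortExact_of_exact f g hf hg hfg) Y _ hA hC

/-- Over a Cohen-Macaulay local ring of dimension one, a finitely generated module of finite
injective dimension has no first extensions by torsion-free modules. -/
theorem ext_one_subsingleton {x : R} (hreg : IsSMulRegular R x)
    (hx : x ∈ maximalIdeal R) (hmax : ∀ p : Ideal R, p.IsPrime → x ∈ p → p = maximalIdeal R)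
    (Y : ModuleCat.{u} R) [Module.Finite R Y] (hY : ∃ n : ℕ, HasInjectiveDimensionLE Y n)
    (M : Type u) [AddCommGroup M] [Module R M] [Module.Finite R M] (hM : IsSMulRegular M x) :
    Subsingleton (Ext (ModuleCat.of R M) Y 1) := by
  obtain ⟨n, hn⟩ := hY
  have key : ∀ m : ℕ, (∀ (X : Type u) [AddCommGroup X] [Module R X] [Module.Finite R X],
      Subsingleton (Ext (ModuleCat.of R X) Y (m + 2))) →
      ∀ (X : Type u) [AddCommGroup X] [Module R X] [Module.Finite R X],
        Subsingleton (Ext (ModuleCat.of R X) Y 2) := by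
    intro m
    induction m with
    | zero => exact id
    | succ m ih => exact fun h => ih (ext_subsingleton_descend hreg hx hmax Y m h)
  -- The descent stops at `Ext^2`; the regular element `x` on `M` gives the last step to `Ext^1`.
  refine ext_subsingleton_of_isSMulRegular (ModuleCat.of R M) Y hx hM 1 (key n (fun X _ _ _ => ?_) _)
  exact HasInjectiveDimensionLT.subsingleton Y (n + 1) (n + 2) (by lia) _

end ExtModule

end HunekeWiegand

namespace HunekeWiegand

open IsLocalRing
open scoped Pointwise

/-! ### Matlis duality modulo `x` and its lift to torsion-free modules -/

section Matlis

variable {R : Type u} [CommRing R]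

theorem length_linearMap_le_add {A B C E : Type u} [AddCommGroup A] [Module R A] [AddCommGroup B]
    [Module R B] [AddCommGroup C] [Module R C] [AddCommGroup E] [Module R E] (f : A →ₗ[R] B)
    (g : B →ₗ[R] C) (hg : Function.Surjective g) (hfg : Function.Exact f g) :
    Module.length R (B →ₗ[R] E) ≤ Module.length R (A →ₗ[R] E) + Module.length R (C →ₗ[R] E) := by
  let ρ : (B →ₗ[R] E) →ₗ[R] (A →ₗ[R] E) := LinearMap.lcomp R E f
  rw [Module.length_eq_add_of_exact (LinearMap.lcomp R E g) ρ.rangeRestrict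
    (LinearMap.lcomp_injective_of_surjective g hg) ρ.surjective_rangeRestrict, add_comm]
  · gcongr
    exact Module.length_le_of_injective _ (LinearMap.range ρ).injective_subtype
  · intro h
    rw [← LinearMap.mem_ker, LinearMap.ker_rangeRestrict, LinearMap.mem_ker]
    exact LinearMap.exact_lcomp_of_exact_of_surjective _ hfg hg h

theorem exists_comp_eq_of_surjective {A B C : Type u} [AddCommGroup A] [Module R A]
    [AddCommGroup B] [Module R B] [AddCommGroup C] [Module R C] (π : A →ₗ[R] B)
    (hπ : Function.Surjective π) (ψ : A →ₗ[R] C) (h : LinearMap.ker π ≤ LinearMap.ker ψ) :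
    ∃ θ : B →ₗ[R] C, ∀ a, θ (π a) = ψ a := by
  refine ⟨(LinearMap.ker π).liftQ ψ h ∘ₗ (π.quotKerEquivOfSurjective hπ).symm.toLinearMap,
    fun a => ?_⟩
  have he : (π.quotKerEquivOfSurjective hπ).symm (π a) = (LinearMap.ker π).mkQ a := by
    rw [LinearEquiv.symm_apply_eq]
    rfl
  change (LinearMap.ker π).liftQ ψ h ((π.quotKerEquivOfSurjective hπ).symm (π a)) = ψ a
  rw [he]
  rfl

theorem exists_smul_eq_of_mkQ_eq_zero {M N : Type u} [AddCommGroup M] [Module R M]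
    [AddCommGroup N] [Module R N] {x : R} (hN : IsSMulRegular N x) (f : M →ₗ[R] N)
    (h : ∀ m, (x • (⊤ : Submodule R N)).mkQ (f m) = 0) : ∃ f' : M →ₗ[R] N, x • f' = f := by
  let μ : N →ₗ[R] N := LinearMap.lsmul R N x
  have hf (m : M) : f m ∈ LinearMap.range μ :=
    (LinearMap.exact_lsmul_mkQ_smul_top N x (f m)).mp (h m)
  refine ⟨(LinearEquiv.ofInjective μ hN).symm.toLinearMap ∘ₗ f.codRestrict _ hf,
    LinearMap.ext fun m => ?_⟩
  exact congrArg Subtype.val ((LinearEquiv.ofInjective μ hN).apply_symm_apply ⟨f m, hf m⟩)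

/-- If homomorphisms from torsion-free modules to `N / xN` lift to `N`, then `N / xN` is injective
with respect to finitely generated modules annihilated by `x`. -/
theorem exists_extend_quotSMulTop [IsNoetherianRing R] {x : R} {N : Type u} [AddCommGroup N]
    [Module R N] (hR : IsSMulRegular R x) (hN : IsSMulRegular N x)
    (hlift : ∀ (M : Type u) [AddCommGroup M] [Module R M] [Module.Finite R M], IsSMulRegular M x →
      ∀ f : M →ₗ[R] QuotSMulTop x N, ∃ g : M →ₗ[R] N, (x • (⊤ : Submodule R N)).mkQ ∘ₗ g = f)
    {L : Type u} [AddCommGroup L] [Module R L] [Module.Finite R L] (hxL : ∀ l : L, x • l = 0)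
    (P : Submodule R L) (g : P →ₗ[R] QuotSMulTop x N) :
    ∃ f : L →ₗ[R] QuotSMulTop x N, f ∘ₗ P.subtype = g := by
  obtain ⟨n, π, hπ⟩ := Module.Finite.exists_fin' R L
  -- `Q` is torsion-free for `x` and contains `x R^n`, so `g ∘ π` lifts to `h : Q → N`.
  let Q := P.comap π
  let πQ : Q →ₗ[R] P := π.restrict (fun _ h => h)
  obtain ⟨h, hh⟩ := hlift Q (IsSMulRegular.submodule Q x (IsSMulRegular.pi fun _ => hR)) (g ∘ₗ πQ)
  have hh' (q : Q) : (x • (⊤ : Submodule R N)).mkQ (h q) = g (πQ q) := LinearMap.congr_fun hh q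
  have hxQ (v : Fin n → R) : x • v ∈ Q := by
    change π (x • v) ∈ P
    rw [map_smul, hxL]
    exact P.zero_mem
  let ξ : (Fin n → R) →ₗ[R] Q := (LinearMap.lsmul R (Fin n → R) x).codRestrict Q hxQ
  -- As `π` kills `x R^n`, `h` maps it into `xN`. Dividing by `x` yields `φ` on all of `R^n`
  -- extending `h`; modulo `x` it kills `ker π` and descends to `L`.
  obtain ⟨φ, hφ⟩ := exists_smul_eq_of_mkQ_eq_zero hN (h ∘ₗ ξ) fun v => by
    have h0 : πQ (ξ v) = 0 := Subtype.ext (show π (x • v) = 0 by rw [map_smul, hxL])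
    have h1 := hh' (ξ v)
    rwa [h0, map_zero] at h1
  have hφQ (q : Q) : (x • (⊤ : Submodule R N)).mkQ (φ q) = g (πQ q) := by
    rw [← hh']
    congr 1
    refine hN ?_
    change x • φ q = x • h q
    rw [← map_smul h]
    exact LinearMap.congr_fun hφ q
  obtain ⟨θ, hθ⟩ := exists_comp_eq_of_surjective π hπ ((x • (⊤ : Submodule R N)).mkQ ∘ₗ φ)
    fun v hv => by
      have hvQ : π v ∈ P := by
        rw [LinearMap.mem_ker.mp hv]
        exact P.zero_mem
      have h3 : πQ ⟨v, hvQ⟩ = 0 := Subtype.ext hv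
      have h2 := hφQ ⟨v, hvQ⟩
      rwa [h3, map_zero] at h2
  refine ⟨θ, LinearMap.ext fun p => ?_⟩
  obtain ⟨v, hv⟩ := hπ p
  have hvQ : π v ∈ P := by
    rw [hv]
    exact p.2
  have h3 : πQ ⟨v, hvQ⟩ = p := Subtype.ext hv
  rw [← h3, ← hφQ ⟨v, hvQ⟩]
  exact hθ v

variable [IsLocalRing R] [IsNoetherianRing R] {x : R}

/-- All factors `R/p` of a prime filtration of `L` are residue fields, because `x` lies in each `p`;
both sides are then compared along the filtration. -/
theorem length_linearMap_le (hmax : ∀ p : Ideal R, p.IsPrime → x ∈ p → p = maximalIdeal R)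
    (E : Type u) [AddCommGroup E] [Module R E]
    (hE : Module.length R ((R ⧸ maximalIdeal R) →ₗ[R] E) ≤ 1)
    (L : Type u) [AddCommGroup L] [Module R L] [hL : Module.Finite R L] (hxL : ∀ l : L, x • l = 0) :
    IsFiniteLength R L ∧ Module.length R (L →ₗ[R] E) ≤ Module.length R L := by
  induction hL using IsNoetherianRing.induction_on_isQuotientEquivQuotientPrime R with
  | subsingleton N => exact ⟨.of_subsingleton, by rw [Module.length_eq_zero]; exact bot_le⟩
  | quotient N p e =>
    have hp : p.1 = maximalIdeal R := hmax p.1 p.2 (by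
      have h := hxL (e.symm 1)
      rw [← map_smul, LinearEquiv.map_eq_zero_iff, Algebra.smul_def, mul_one] at h
      exact Ideal.Quotient.eq_zero_iff_mem.mp h)
    rw [hp] at e
    have hs : IsSimpleModule R (R ⧸ maximalIdeal R) :=
      isSimpleModule_iff_isCoatom.mpr (maximalIdeal.isMaximal R).out
    have h1 : Module.length R N = 1 := by
      rw [e.length_eq, Module.length_eq_one]
    refine ⟨?_, ?_⟩
    · rw [← Module.length_ne_top_iff, h1]
      simp
    · rw [h1, (LinearEquiv.congrLeft E R e).length_eq]
      exact hE
  | exact A B C f g hf hg hfg hA hC =>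
    have hA := hA fun a => hf (by rw [map_smul, hxL, map_zero])
    have hC := hC fun c => by
      obtain ⟨b, rfl⟩ := hg c
      rw [← map_smul, hxL, map_zero]
    have hlen := Module.length_eq_add_of_exact f g hf hg hfg
    refine ⟨?_, ?_⟩
    · rw [← Module.length_ne_top_iff, hlen]
      exact WithTop.add_ne_top.mpr
        ⟨Module.length_ne_top_iff.mpr hA.1, Module.length_ne_top_iff.mpr hC.1⟩
    · rw [hlen]
      exact (length_linearMap_le_add f g hg hfg).trans (add_le_add hA.2 hC.2)

/-- A module which is injective with respect to modules annihilated by `x` and contains the residue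
field separates points of modules annihilated by `x`. -/
theorem exists_linearMap_apply_ne_zero
    (hmax : ∀ p : Ideal R, p.IsPrime → x ∈ p → p = maximalIdeal R)
    (E : Type u) [AddCommGroup E] [Module R E] [Nontrivial E] (hxE : ∀ e : E, x • e = 0)
    {L : Type u} [AddCommGroup L] [Module R L]
    (hinj : ∀ (P : Submodule R L) (g : P →ₗ[R] E), ∃ f : L →ₗ[R] E, f ∘ₗ P.subtype = g)
    {l : L} (hl : l ≠ 0) : ∃ f : L →ₗ[R] E, f l ≠ 0 := by
  obtain ⟨i, hi⟩ := exists_residueField_injective hmax E hxE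
  let τ := LinearMap.toSpanSingleton R L l
  have hτ : LinearMap.ker τ ≤ maximalIdeal R := by
    refine IsLocalRing.le_maximalIdeal fun h => hl ?_
    have h1 : (1 : R) ∈ LinearMap.ker τ := h ▸ trivial
    simpa [τ] using h1
  -- The cyclic module `R l` surjects onto the residue field, which embeds into `E`; this map is
  -- nonzero at `l` and extends to `L`.
  obtain ⟨f, hf⟩ := hinj (LinearMap.range τ)
    (i ∘ₗ Submodule.factor hτ ∘ₗ τ.quotKerEquivRange.symm.toLinearMap)
  refine ⟨f, fun h0 => ?_⟩
  have h1 : τ.quotKerEquivRange.symm ⟨τ 1, LinearMap.mem_range_self τ 1⟩ =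
      (LinearMap.ker τ).mkQ 1 := by
    rw [LinearEquiv.symm_apply_eq]
    rfl
  have h2 := LinearMap.congr_fun hf ⟨τ 1, LinearMap.mem_range_self τ 1⟩
  change f (τ 1) = i (Submodule.factor hτ (τ.quotKerEquivRange.symm _)) at h2
  rw [h1, LinearMap.toSpanSingleton_apply, one_smul, h0] at h2
  have h3 := hi (h2.symm.trans (map_zero i).symm)
  have h4 : Ideal.Quotient.mk (maximalIdeal R) 1 = 0 := h3
  rw [map_one] at h4
  exact one_ne_zero h4

/-- Matlis duality for finitely generated modules annihilated by `x`. -/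
theorem bijective_eval_of_smul_eq_zero
    (hmax : ∀ p : Ideal R, p.IsPrime → x ∈ p → p = maximalIdeal R)
    (E : Type u) [AddCommGroup E] [Module R E] [Module.Finite R E] [Nontrivial E]
    (hxE : ∀ e : E, x • e = 0)
    (hE : Module.length R ((R ⧸ maximalIdeal R) →ₗ[R] E) ≤ 1)
    {L : Type u} [AddCommGroup L] [Module R L] [Module.Finite R L] (hxL : ∀ l : L, x • l = 0)
    (hinj : ∀ (P : Submodule R L) (g : P →ₗ[R] E), ∃ f : L →ₗ[R] E, f ∘ₗ P.subtype = g) :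
    Function.Bijective (LinearMap.applyₗ : L →ₗ[R] ((L →ₗ[R] E) →ₗ[R] E)) := by
  have hinj' : Function.Injective (LinearMap.applyₗ : L →ₗ[R] ((L →ₗ[R] E) →ₗ[R] E)) := by
    refine (injective_iff_map_eq_zero _).mpr fun l hl => ?_
    by_contra hl0
    obtain ⟨f, hf⟩ := exists_linearMap_apply_ne_zero hmax E hxE hinj hl0
    exact hf (LinearMap.congr_fun hl f)
  refine ⟨hinj', ?_⟩
  have h1 := length_linearMap_le hmax E hE L hxL
  have h2 := length_linearMap_le hmax E hE (L →ₗ[R] E) fun f => LinearMap.ext fun l => hxE (f l)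
  have h3 := length_linearMap_le hmax E hE ((L →ₗ[R] E) →ₗ[R] E)
    fun f => LinearMap.ext fun l => hxE (f l)
  obtain ⟨_, _⟩ := isFiniteLength_iff_isNoetherian_isArtinian.mp h3.1
  -- The bidual is no longer than `L`, so an injective evaluation cannot have proper image.
  by_contra hs
  have h4 := Submodule.length_lt (mt LinearMap.range_eq_top.mp hs)
  rw [← (LinearEquiv.ofInjective _ hinj').length_eq] at h4
  exact (h4.trans_le (h2.2.trans h1.2)).false

/-- Reflexivity of torsion-free modules with respect to `N`. -/
theorem bijective_eval_of_isSMulRegular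
    (hmax : ∀ p : Ideal R, p.IsPrime → x ∈ p → p = maximalIdeal R) (hx : x ∈ maximalIdeal R)
    {N : Type u} [AddCommGroup N] [Module R N] [Module.Finite R N] [Nontrivial N]
    (hR : IsSMulRegular R x) (hN : IsSMulRegular N x)
    (hlift : ∀ (M : Type u) [AddCommGroup M] [Module R M] [Module.Finite R M], IsSMulRegular M x →
      ∀ f : M →ₗ[R] QuotSMulTop x N, ∃ g : M →ₗ[R] N, (x • (⊤ : Submodule R N)).mkQ ∘ₗ g = f)
    (hE : Module.length R ((R ⧸ maximalIdeal R) →ₗ[R] QuotSMulTop x N) ≤ 1)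
    {M : Type u} [AddCommGroup M] [Module R M] [Module.Finite R M] (hM : IsSMulRegular M x) :
    Function.Bijective (LinearMap.applyₗ : M →ₗ[R] ((M →ₗ[R] N) →ₗ[R] N)) := by
  let qM := (x • (⊤ : Submodule R M)).mkQ
  let qN := (x • (⊤ : Submodule R N)).mkQ
  have hzero (A : Type u) [AddCommGroup A] [Module R A] (a : QuotSMulTop x A) : x • a = 0 :=
    Module.mem_annihilator.mp (QuotSMulTop.mem_annihilator A x) a
  have hker (A : Type u) [AddCommGroup A] [Module R A] (a : A) :
      (x • (⊤ : Submodule R A)).mkQ (x • a) = 0 := by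
    rw [map_smul]
    exact hzero A _
  have hlift' (g : QuotSMulTop x M →ₗ[R] QuotSMulTop x N) :
      ∃ f : M →ₗ[R] N, ∀ m, qN (f m) = g (qM m) := by
    obtain ⟨f, hf⟩ := hlift M hM (g ∘ₗ qM)
    exact ⟨f, LinearMap.congr_fun hf⟩
  have hext := exists_extend_quotSMulTop hR hN hlift (hzero M)
  have : Nontrivial (QuotSMulTop x N) := nontrivial_quotSMulTop_of_mem_maximalIdeal N hx
  have hle : Ideal.span {x} ≤ (⊥ : Ideal R).jacobson := by
    rw [Ideal.span_singleton_le_iff_mem, IsLocalRing.jacobson_eq_maximalIdeal ⊥ bot_ne_top]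
    exact hx
  constructor
  · rw [← LinearMap.ker_eq_bot]
    -- The kernel `K` satisfies `K ⊆ xK`: its elements lie in `xM` by duality modulo `x`, and
    -- division by `x` stays in `K` since `N` is `x`-regular.
    refine Submodule.eq_bot_of_le_smul_of_le_jacobson_bot (Ideal.span {x}) _
      (IsNoetherian.noetherian _) (fun m hm => ?_) hle
    have hm' (f : M →ₗ[R] N) : f m = 0 := LinearMap.congr_fun hm f
    have h0 : qM m = 0 := by
      by_contra hne
      obtain ⟨g, hg⟩ := exists_linearMap_apply_ne_zero hmax _ (hzero N) hext hne
      obtain ⟨f, hf⟩ := hlift' g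
      exact hg (by rw [← hf, hm', map_zero])
    obtain ⟨m', rfl⟩ := (LinearMap.exact_lsmul_mkQ_smul_top M x m).mp h0
    refine Submodule.smul_mem_smul (Ideal.mem_span_singleton_self x)
      (LinearMap.mem_ker.mpr (LinearMap.ext fun f => hN ?_))
    have := hm' f
    rw [LinearMap.lsmul_apply, map_smul] at this
    exact this.trans (smul_zero x).symm
  · rw [← LinearMap.range_eq_top, eq_top_iff]
    refine Submodule.le_of_le_smul_of_le_jacobson_bot (I := Ideal.span {x})
      Module.Finite.fg_top hle fun φ _ => ?_
    -- Reduction modulo `x` is surjective with kernel `x Hom(M, N)`. So `φ` induces `θ` on the dual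
    -- of `M/xM`, which is evaluation at some `m`; thus `φ` agrees with evaluation at `m` up to a
    -- multiple of `x`.
    let β : (M →ₗ[R] N) →ₗ[R] (QuotSMulTop x M →ₗ[R] QuotSMulTop x N) := QuotSMulTop.map x
    have hβ (f : M →ₗ[R] N) (m : M) : β f (qM m) = qN (f m) := rfl
    have hβs : Function.Surjective β := fun g => by
      obtain ⟨f, hf⟩ := hlift' g
      refine ⟨f, LinearMap.ext fun l => ?_⟩
      obtain ⟨m, rfl⟩ := Submodule.mkQ_surjective _ l
      exact hf m
    obtain ⟨θ, hθ⟩ := exists_comp_eq_of_surjective β hβs (qN ∘ₗ φ) fun f hf => by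
      obtain ⟨f', rfl⟩ := exists_smul_eq_of_mkQ_eq_zero hN f fun m => by
        rw [← hβ f m, LinearMap.mem_ker.mp hf, LinearMap.zero_apply]
      rw [LinearMap.mem_ker, LinearMap.comp_apply, map_smul φ]
      exact hker N _
    obtain ⟨l, hl⟩ := (bijective_eval_of_smul_eq_zero hmax _ (hzero N) hE (hzero M) hext).2 θ
    obtain ⟨m, rfl⟩ := Submodule.mkQ_surjective _ l
    obtain ⟨χ, hχ⟩ := exists_smul_eq_of_mkQ_eq_zero hN (φ - LinearMap.applyₗ m) fun f => by
      have h1 : qN (φ f) = β f (qM m) := by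
        rw [← LinearMap.comp_apply, ← hθ, ← hl]
        rfl
      rw [LinearMap.sub_apply, map_sub, sub_eq_zero]
      exact h1
    rw [← sub_add_cancel φ (LinearMap.applyₗ m), ← hχ, add_comm]
    exact Submodule.add_mem_sup (LinearMap.mem_range_self _ m)
      (Submodule.smul_mem_smul (Ideal.mem_span_singleton_self x) trivial)

end Matlis
end HunekeWiegand

namespace HunekeWiegand

open IsLocalRing CategoryTheory

/-! ### Canonical duality and the equivalence -/

section Duality

variable {R : Type u} [CommRing R]

/-- Hom out of a finitely presented module commutes with localization, so ranks multiply. This keeps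
`M^∨` among the modules with rank. -/
theorem HasRank.linearMap [IsNoetherianRing R] {M N : Type u} [AddCommGroup M] [Module R M]
    [Module.Finite R M] [AddCommGroup N] [Module R N] (hM : HasRank R M) (hN : HasRank R N) :
    HasRank R (M →ₗ[R] N) := by
  obtain ⟨r, hr⟩ := hM
  obtain ⟨s, hs⟩ := hN
  refine ⟨r * s, fun p _ hp => ?_⟩
  obtain ⟨e⟩ := hr p hp
  obtain ⟨e'⟩ := hs p hp
  have : Module.FinitePresentation R M := Module.finitePresentation_of_finite R M
  let A := Localization.AtPrime p
  let e₁ : LocalizedModule p.primeCompl (M →ₗ[R] N) ≃ₗ[A]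
      (LocalizedModule p.primeCompl M →ₗ[A] LocalizedModule p.primeCompl N) :=
    (Module.FinitePresentation.linearEquivMapExtendScalars
      p.primeCompl).extendScalarsOfIsLocalization p.primeCompl A
  exact ⟨e₁ ≪≫ₗ e.arrowCongr e' ≪≫ₗ LinearEquiv.ofFinrankEq _ _ (by
    rw [Module.finrank_linearMap]
    simp)⟩

theorem isTorsionFree_of_linearEquiv {M N : Type*} [AddCommMonoid M] [Module R M] [AddCommMonoid N]
    [Module R N] (e : M ≃ₗ[R] N) (h : Module.IsTorsionFree R N) : Module.IsTorsionFree R M :=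
  e.injective.moduleIsTorsionFree e (map_smul e)

theorem isTorsionFree_linearMap {M N : Type*} [AddCommGroup M] [Module R M] [AddCommGroup N]
    [Module R N] (h : Module.IsTorsionFree R N) : Module.IsTorsionFree R (M →ₗ[R] N) where
  isSMulRegular _ hr _ _ hfg :=
    LinearMap.ext fun m => h.isSMulRegular hr (LinearMap.congr_fun hfg m)

theorem IsCanonicalModule.bijective_eval [IsLocalRing R] (hCM : IsCohenMacaulayLocalRing R)
    (hdim : ringKrullDim R = 1) {ω : Type u} [AddCommGroup ω] [Module R ω]
    (hω : IsCanonicalModule R ω) (M : Type u) [AddCommGroup M] [Module R M] [Module.Finite R M]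
    (hM : Module.IsTorsionFree R M) :
    Function.Bijective (LinearMap.applyₗ : M →ₗ[R] ((M →ₗ[R] ω) →ₗ[R] ω)) := by
  have := hCM.1
  have := hω.finite
  obtain ⟨-, -, x, hx, hR⟩ := hCM.2.exists_isSMulRegular hdim
  obtain ⟨_, hdepth, y, hy, hωy⟩ := hω.maximalCohenMacaulay.exists_isSMulRegular hdim
  have hxreg : IsRegular x := ⟨hR, fun a b h => hR (by simpa [mul_comm] using h)⟩
  have hmax (p : Ideal R) (hp : p.IsPrime) (hxp : x ∈ p) : p = maximalIdeal R :=
    eq_maximalIdeal_of_mem_of_isRegular hdim hxreg p hxp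
  have hωx : IsSMulRegular ω x := (isTorsionFree_of_isSMulRegular hdim hy hωy).isSMulRegular hxreg
  refine bijective_eval_of_isSMulRegular hmax hx hR hωx (fun M _ _ _ hM f => ?_) ?_
    (hM.isSMulRegular hxreg)
  · exact exists_lift_quotSMulTop hωx (ext_one_subsingleton hR hx hmax (ModuleCat.of R ω)
      hω.finite_injectiveDimension M hM) f
  · refine (length_linearMap_quotSMulTop_le hωx fun k => ?_).trans ?_
    · obtain ⟨a, rfl⟩ := Ideal.Quotient.mk_surjective k
      rw [Algebra.smul_def, Ideal.Quotient.algebraMap_eq, Ideal.Quotient.eq_zero_iff_mem.mpr hx,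
        zero_mul]
    · have h := hω.type_eq_one
      rw [cmType, hdepth] at h
      exact h.le

theorem IsCanonicalModule.isTorsionFree [IsLocalRing R] (hdim : ringKrullDim R = 1)
    {ω : Type u} [AddCommGroup ω] [Module R ω] (hω : IsCanonicalModule R ω) :
    Module.IsTorsionFree R ω := by
  obtain ⟨-, -, y, hy, hωy⟩ := hω.maximalCohenMacaulay.exists_isSMulRegular hdim
  exact isTorsionFree_of_isSMulRegular hdim hy hωy

/-- If `R ≅ Hom(ω, ω)`, then `Hom(ω, Hom(M, ω)) ≅ Hom(M, R)`. -/
noncomputable def dualEquiv {ω : Type u} [AddCommGroup ω] [Module R ω] (e : R ≃ₗ[R] (ω →ₗ[R] ω))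
    (M : Type u) [AddCommGroup M] [Module R M] :
    (ω →ₗ[R] (M →ₗ[R] ω)) ≃ₗ[R] (M →ₗ[R] R) :=
  LinearMap.lflip (R₀ := R) ≪≫ₗ LinearEquiv.congrRight e.symm

/-- Homomorphisms out of a finite free module. -/
noncomputable def piLinearMapEquiv (n : ℕ) (A B : Type u) [AddCommGroup A] [Module R A]
    [AddCommGroup B] [Module R B] : ((Fin n → A) →ₗ[R] B) ≃ₗ[R] (Fin n → A →ₗ[R] B) :=
  (LinearMap.lsum R (fun _ : Fin n => A) R).symm

end Duality

end HunekeWiegand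

theorem proposition3p10 (R : Type u) [CommRing R] [IsLocalRing R]
    (hCM : HunekeWiegand.IsCohenMacaulayLocalRing R) (hdim : ringKrullDim R = 1)
    (ω : Type u) [AddCommGroup ω] [Module R ω] (hω : HunekeWiegand.IsCanonicalModule R ω)
    (hrank : HunekeWiegand.HasRank R ω) :
    HunekeWiegand.Conjecture R ↔ HunekeWiegand.CanonicalConjecture R ω := by
  have := hCM.1
  have := hω.finite
  have hωtf := hω.isTorsionFree hdim
  have hbid (M : Type u) [AddCommGroup M] [Module R M] [Module.Finite R M]
      (hM : Module.IsTorsionFree R M) : Nonempty (M ≃ₗ[R] ((M →ₗ[R] ω) →ₗ[R] ω)) :=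
    ⟨LinearEquiv.ofBijective _ (hω.bijective_eval hCM hdim M hM)⟩
  obtain ⟨eR⟩ := hbid R inferInstance
  -- Biduality of `R` itself, with `Hom(R, ω) ≅ ω`.
  let e : R ≃ₗ[R] (ω →ₗ[R] ω) :=
    eR ≪≫ₗ LinearEquiv.congrLeft ω R (LinearMap.ringLmapEquivSelf R R ω)
  constructor
  · intro H M _ _ hMf hM hMr hT
    obtain ⟨eM⟩ := hbid M hM
    -- Here `(M^∨)^* ≅ Hom(ω, M^∨∨) ≅ Hom(ω, M)`.
    have hfree := H (M →ₗ[R] ω) inferInstance (HunekeWiegand.isTorsionFree_linearMap hωtf)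
      (hMr.linearMap hrank) (HunekeWiegand.isTorsionFree_of_linearEquiv
        (TensorProduct.congr ((HunekeWiegand.dualEquiv e (M →ₗ[R] ω)).symm ≪≫ₗ
          LinearEquiv.congrRight eM.symm) (LinearEquiv.refl R _) ≪≫ₗ
          TensorProduct.comm R _ _) hT)
    refine ⟨Module.finrank R (M →ₗ[R] ω), ⟨?_⟩⟩
    exact eM ≪≫ₗ LinearEquiv.congrLeft ω R (Module.finBasis R (M →ₗ[R] ω)).equivFun ≪≫ₗ
      HunekeWiegand.piLinearMapEquiv _ R ω ≪≫ₗ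
      LinearEquiv.piCongrRight fun _ => LinearMap.ringLmapEquivSelf R R ω
  · intro H M _ _ hMf hM hMr hT
    obtain ⟨eM⟩ := hbid M hM
    -- Here `M^∨∨ ⊗ Hom(ω, M^∨) ≅ M ⊗ M^*`.
    obtain ⟨n, ⟨f⟩⟩ := H (M →ₗ[R] ω) inferInstance (HunekeWiegand.isTorsionFree_linearMap hωtf)
      (hMr.linearMap hrank) (HunekeWiegand.isTorsionFree_of_linearEquiv
        (TensorProduct.comm R _ _ ≪≫ₗ
          TensorProduct.congr (HunekeWiegand.dualEquiv e M) eM.symm) hT)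
    exact Module.Free.of_equiv (eM ≪≫ₗ LinearEquiv.congrLeft ω R f ≪≫ₗ
      HunekeWiegand.piLinearMapEquiv n ω ω ≪≫ₗ LinearEquiv.piCongrRight fun _ => e.symm).symm
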